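/- **Slow mixing from a linear free-energy barrier in a transverse field.** For $n$ qubits let $H_0=-\sum_{j\in J} c_j\, Z_{i_1(j)}\cdots Z_{i_{k_j}(j)}$ be a classical Hamiltonian (a finite sum of products of Pauli-$Z$ operators with real coefficients $c_j$) with $|c_j|\le 1/\deg(H_0)$ for all $j$, where $\deg(H_0)$ is the maximum, over the qubits, of the number of terms with nonzero coefficient in which the qubit appears (no condition if $\deg(H_0)=0$). For $h\ge 0$ let $H=H_0-h\sum_{i=1}^n X_i$, and for $\beta>0$ let $\rho_\beta^{(0)}=e^{-\beta H_0}/\operatorname{Tr}e^{-\beta H_0}$ and $\rho_\beta=e^{-\beta H}/\operatorname{Tr}e^{-\beta H}$. A quantum channel (completely positive trace-preserving map) $\mathcal T$ on $n$-qubit operators is *$\ell$-local* if $\mathcal T(\rho)=\sum_j K_j\rho K_j'$ for finitely many operators $K_j,K_j'$, each acting nontrivially on at most $\ell$ qubits. It is a (discrete-time) *Gibbs sampler* with respect to $\rho_\beta$ if $\mathcal T(\rho_\beta)=\rho_\beta$. For a fixed constant $\epsilon\le\frac12$, its mixing time $T_{\mathrm{mix}}(\mathcal T)$ is the smallest $t\in\mathbb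 N$ such that $\|\mathcal T^{t}(\rho-\sigma)\|_1\le\epsilon\|\rho-\sigma\|_1$ for all states $\rho,\sigma$ (and $\infty$ if there is none), where $\|\cdot\|_1$ is the trace norm. **Proposition.** Let $\beta,a,d,w>0$ and $\epsilon\le\frac12$ be constants. There are $\kappa>0$ and $N\in\mathbb N$, depending only on these constants, such that the following holds for all $n\ge N$, all $H_0$ as above, and all $$0\le h<\min\Big\{\tfrac12,\ \tfrac1\beta,\ \exp\!\Big[-\tfrac{3\beta}{2d}\Big],\ \tfrac{\sqrt a}{\sqrt3\,\beta}\,e^{-\beta}\Big\}.$$ Let $A,C$ be orthogonal subspaces of $(\mathbb C^2)^{\otimes n}$ whose projectors $\Pi_A,\Pi_C$ are diagonal in the computational basis, such that $|x-y|_H>dn$ for all bitstrings $x,y$ with $\langle x|\Pi_A|x\rangle\ne0$ and $\langle y|\Pi_C|y\rangle\neq0$ (Hamming distance). Put $\Pi_B=I-\Pi_A-\Pi_C$ and assume $$\operatorname{Tr}[\Pi_A\rho_\beta^{(0)}]\ge w,\qquad \operatorname{Tr}[\Pi_C\rho_\beta^{(0)}]\ge w,\qquad \operatorname{Tr}[\Pi_B\rho_\beta^{(0)}]\le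 e^{-an}.$$ Then every $\ell$-local quantum Gibbs sampler $\mathcal T$ with respect to $\rho_\beta$ with $\ell<dn$ satisfies $T_{\mathrm{mix}}(\mathcal T)\ge e^{\kappa n}$. That is, $T_{\mathrm{mix}}(\mathcal T)\ge\exp[\Omega(n)]$. -/

import Mathlib

open scoped ENNReal ComplexOrder

noncomputable section

namespace GibbsMixing

/-- Bitstrings of length `n`; they label the computational basis of `n` qubits. -/
abbrev Bits (n : ℕ) : Type := Fin n → Fin 2

/-- Operators on the Hilbert space of `n` qubits, as matrices in the computational basis. -/
abbrev Op (n : ℕ) : Type := Matrix (Bits n) (Bits n) ℂ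

/-- Linear maps on operators. -/
abbrev SuperOp (n : ℕ) : Type := Op n →ₗ[ℂ] Op n

def pauliX : Matrix (Fin 2) (Fin 2) ℂ := !![0, 1; 1, 0]

def pauliZ : Matrix (Fin 2) (Fin 2) ℂ := !![1, 0; 0, -1]

/-- The operator `I ⊗ ⋯ ⊗ P ⊗ ⋯ ⊗ I` with `P` on qubit `i`. -/
def onSite {n : ℕ} (i : Fin n) (P : Matrix (Fin 2) (Fin 2) ℂ) : Op n :=
  fun x y => if ∀ j, j ≠ i → x j = y j then P (x i) (y i) else 0

/-- The product `Z_{i₁} Z_{i₂} ⋯ Z_{iₖ}` over a tuple of qubits. -/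
def zString {n : ℕ} (l : List (Fin n)) : Op n := (l.map fun i => onSite i pauliZ).prod

/-- The classical Hamiltonian `H₀ = -∑ⱼ cⱼ Z_{i₁} ⋯ Z_{iₖ}`, where `(i₁, …, iₖ) = term j`. -/
def classicalHam {n : ℕ} {ι : Type} [Fintype ι] (term : ι → List (Fin n)) (c : ι → ℝ) : Op n :=
  -∑ j, (c j : ℂ) • zString (term j)

/-- The maximum over the qubits of the number of Hamiltonian terms (with a nonzero coefficient)
in which the qubit appears. -/
def degree {n : ℕ} {ι : Type} (term : ι → List (Fin n)) (c : ι → ℝ) : ℕ :=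
  Finset.univ.sup fun i : Fin n => {j : ι | c j ≠ 0 ∧ i ∈ term j}.ncard

/-- The transverse-field Hamiltonian `H₀ - h ∑ᵢ Xᵢ`. -/
def transverseHam {n : ℕ} (H₀ : Op n) (h : ℝ) : Op n :=
  H₀ - (h : ℂ) • ∑ i : Fin n, onSite i pauliX

/-- The Gibbs state `e^{-βH} / Tr e^{-βH}`. -/
def gibbs {n : ℕ} (β : ℝ) (H : Op n) : Op n :=
  (NormedSpace.exp (-((β : ℂ) • H))).trace⁻¹ • NormedSpace.exp (-((β : ℂ) • H))

/-- Density matrices. -/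
def IsState {n : ℕ} (ρ : Op n) : Prop := ρ.PosSemidef ∧ ρ.trace = 1

/-- `T ⊗ id` for an auxiliary system of dimension `m`. -/
def ampliation {n : ℕ} (T : SuperOp n) (m : ℕ)
    (M : Matrix (Bits n × Fin m) (Bits n × Fin m) ℂ) :
    Matrix (Bits n × Fin m) (Bits n × Fin m) ℂ :=
  fun p q => T (Matrix.of fun x y => M (x, p.2) (y, q.2)) p.1 q.1

/-- Quantum channels: completely positive trace-preserving maps. -/
structure IsChannel {n : ℕ} (T : SuperOp n) : Prop where
  completelyPositive : ∀ (m : ℕ) (M : Matrix (Bits n × Fin m) (Bits n × Fin m) ℂ),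
    M.PosSemidef → (ampliation T m M).PosSemidef
  tracePreserving : ∀ M : Op n, (T M).trace = M.trace

/-- `K` acts nontrivially only on the qubits in `S`, that is, `K = M ⊗ I` with `M` on `S`. -/
def ActsOn {n : ℕ} (S : Finset (Fin n)) (K : Op n) : Prop :=
  ∃ M : Matrix (S → Fin 2) (S → Fin 2) ℂ, ∀ x y : Bits n,
    K x y = if ∀ i, i ∉ S → x i = y i then M (fun i => x i) (fun i => y i) else 0

/-- `K` acts nontrivially on at most `l` qubits. -/
def IsLocalOp {n : ℕ} (l : ℕ) (K : Op n) : Prop :=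
  ∃ S : Finset (Fin n), S.card ≤ l ∧ ActsOn S K

/-- `T(ρ) = ∑ⱼ Kⱼ ρ K'ⱼ` where every `Kⱼ` and every `K'ⱼ` acts nontrivially on at most
`l` qubits. -/
def IsLocalMap {n : ℕ} (l : ℕ) (T : SuperOp n) : Prop :=
  ∃ (r : ℕ) (K K' : Fin r → Op n), (∀ j, IsLocalOp l (K j)) ∧ (∀ j, IsLocalOp l (K' j)) ∧
    ∀ ρ : Op n, T ρ = ∑ j, K j * ρ * K' j

/-- An `l`-local (discrete-time) Gibbs sampler with respect to `ρ`: an `l`-local quantum channel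
that fixes `ρ`. -/
def IsLocalGibbsSampler {n : ℕ} (l : ℕ) (ρ : Op n) (T : SuperOp n) : Prop :=
  IsChannel T ∧ IsLocalMap l T ∧ T ρ = ρ

/-- The trace norm: the sum of the singular values. -/
def traceNorm {n : ℕ} (M : Op n) : ℝ :=
  ∑ i, Real.sqrt ((Matrix.isHermitian_conjTranspose_mul_self M).eigenvalues i)

/-- The mixing time at threshold `ε`: the smallest `t` with
`‖T^t(ρ - σ)‖₁ ≤ ε ‖ρ - σ‖₁` for all states `ρ, σ`, and `⊤` if there is none. -/
def mixingTime {n : ℕ} (ε : ℝ) (T : SuperOp n) : ℕ∞ :=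
  ⨅ (t : ℕ) (_ : ∀ ρ σ : Op n, IsState ρ → IsState σ →
    traceNorm ((T ^ t) (ρ - σ)) ≤ ε * traceNorm (ρ - σ)), (t : ℕ∞)

/-- Orthogonal projectors that are diagonal in the computational basis. -/
def IsDiagProj {n : ℕ} (P : Op n) : Prop := IsStarProjection P ∧ P.IsDiag

/-- The computational-basis (Hamming) distance of the regions of `P` and `Q` exceeds `r`. -/
def HammingSeparated {n : ℕ} (r : ℝ) (P Q : Op n) : Prop :=
  ∀ x y : Bits n, P x x ≠ 0 → Q y y ≠ 0 → r < (hammingDist x y : ℝ)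

end GibbsMixing

end

/-!
The mixing time is bounded below by a bottleneck argument whose initial states are adapted to the
quantum Gibbs state `ρ ∝ G = exp (-β H)`.

For a region `A` of the computational basis with projector `P_A`, the state
`σ_A ∝ G^{1/2} P_A G^{1/2}` (`restrictedState`) is dominated by a multiple of `G`. A channel `T`
fixing `G` preserves this domination, so the weight of `T^t σ_A` on the bottleneck
`B = (A ∪ C)ᶜ` never exceeds a multiple of the equilibrium weight of `B`. Since `T` is local and
`A` and `C` are far apart, the Heisenberg-picture observable of `C` after one step is at most `1`
and lives on `Aᶜ = B ∪ C` (`mass_map_le`): in one step, weight enters `C` only from `B`. Hence the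
weight of `T^t σ_A` on `C` grows at most linearly in `t`, with a slope given by the weight of `B`
(`mass_iterate_le`). The same holds with `A` and `C` exchanged, so `T^t σ_A` and `T^t σ_C` stay
distinguishable until `t` is of the order of the inverse weight of `B` (`half_le_of_contraction`).
Coherences of `ρ` between `A` and `C` enter only through the initial weight of `σ_A` on `C`, which
is proportional to the sum of the squared entries of `exp (-(β / 2) H)` between `A` and `C`.

It remains to compare `exp (-s H)` with `exp (-s H₀)` entrywise. The matrix `-H` has nonnegative
off-diagonal entries, so its flow is monotone and obeys a comparison principle
(`exp_smul_mulVec_le_of_supersolution`). As a bit flip changes the classical energy `E` by at most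
`2`, the function `exp (-s E(x) + n θ² / 2) θ ^ |x - y|` with `θ = h s exp (2 s)` is a supersolution
of the flow started at `x` (`heat_apply_le`). Squaring this bound at `s = β / 2` and summing over
`y` gives `exp (-β E(x)) ≤ G x x ≤ exp (-β E(x) + 2 n θ²)`, and weighting the sum by `exp |x - y|`
shows that the part with `|x - y| ≥ d n` is at most
`exp (-β E(x)) exp (n ((1 + e) θ² - d))`. The assumptions on `h` ensure `2 θ² ≤ a / 6` and
`(1 + e) θ² ≤ 3 d / 4`; the latter uses `d ≤ 1`, which holds because bitstrings at distance more
than `d n` exist.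
-/

/-! ### Exponentials of matrices with nonnegative off-diagonal entries -/

namespace GibbsMixing

open Matrix

section Metzler

open scoped Matrix.Norms.Operator

variable {ι : Type*} [Fintype ι] [DecidableEq ι]

theorem exp_apply_nonneg_of_nonneg {M : Matrix ι ι ℝ} (hM : ∀ x y, 0 ≤ M x y) (x y : ι) :
    0 ≤ NormedSpace.exp M x y := by
  have hpow : ∀ (k : ℕ) (x y : ι), 0 ≤ (M ^ k) x y := by
    intro k
    induction k with
    | zero =>
      intro x y
      rw [pow_zero, Matrix.one_apply]
      split_ifs <;> norm_num
    | succ k ih =>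
      intro x y
      rw [pow_succ, Matrix.mul_apply]
      exact Finset.sum_nonneg fun z _ => mul_nonneg (ih x z) (hM z y)
  have hs := NormedSpace.exp_series_hasSum_exp' (𝕂 := ℝ) M
  have hs' := (Pi.hasSum.1 ((Pi.hasSum.1 hs) x)) y
  refine hs'.nonneg fun k => ?_
  exact mul_nonneg (by positivity) (hpow k x y)

theorem exp_apply_nonneg {L : Matrix ι ι ℝ} (hL : ∀ x y, x ≠ y → 0 ≤ L x y) (x y : ι) :
    0 ≤ NormedSpace.exp L x y := by
  -- Shifting by a multiple of the identity makes all entries nonnegative.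
  set c : ℝ := ∑ z, |L z z|
  have hM : ∀ x y, 0 ≤ (L + diagonal (fun _ => c) : Matrix ι ι ℝ) x y := by
    intro x y
    by_cases hxy : x = y
    · subst hxy
      have h1 : |L x x| ≤ c :=
        Finset.single_le_sum (f := fun z => |L z z|) (fun z _ => abs_nonneg _) (Finset.mem_univ x)
      simp only [Matrix.add_apply, diagonal_apply_eq]
      linarith [neg_abs_le (L x x)]
    · simpa [Matrix.add_apply, diagonal_apply_ne _ hxy] using hL x y hxy
  have hcomm : Commute (L + diagonal fun _ => c) (diagonal fun _ : ι => -c) := by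
    have : (diagonal fun _ : ι => -c) = (-c) • (1 : Matrix ι ι ℝ) := by
      rw [smul_one_eq_diagonal]
    rw [this]
    exact (Commute.one_right _).smul_right _
  have hexp := Matrix.exp_add_of_commute _ _ hcomm
  have hsum : (L + diagonal fun _ => c) + (diagonal fun _ : ι => -c) = L := by
    rw [add_assoc, diagonal_add]
    simp
  rw [hsum] at hexp
  rw [hexp, Matrix.exp_diagonal, mul_diagonal]
  refine mul_nonneg (exp_apply_nonneg_of_nonneg hM x y) ?_
  rw [Pi.coe_exp, ← Real.exp_eq_exp_ℝ]
  exact (Real.exp_pos _).le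

/-- Comparison principle for the linear flow generated by `L`: a supersolution `F` stays above the
solution with the same initial value, because `s ↦ exp ((S - s) L) F(s)` is entrywise monotone. -/
theorem exp_smul_mulVec_le_of_supersolution {L : Matrix ι ι ℝ} (hL : ∀ x y, x ≠ y → 0 ≤ L x y)
    {F F' : ℝ → ι → ℝ} {S : ℝ} (hS : 0 ≤ S)
    (hF : ∀ s, ∀ y, HasDerivAt (fun s => F s y) (F' s y) s)
    (hsup : ∀ s, 0 ≤ s → s ≤ S → ∀ y, (L *ᵥ F s) y ≤ F' s y) (x : ι) :
    (NormedSpace.exp (S • L) *ᵥ F 0) x ≤ F S x := by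
  set E : ℝ → Matrix ι ι ℝ := fun s => NormedSpace.exp ((S - s) • L) with hE
  have hEder : ∀ s y, HasDerivAt (fun s => E s x y) (-(E s * L) x y) s := by
    intro s y
    have h1 := hasDerivAt_exp_smul_const (𝕂 := ℝ) L (S - s)
    have h2 : HasDerivAt (fun s : ℝ => S - s) (-1) s := by
      simpa using (hasDerivAt_id s).const_sub S
    have h3 := h1.scomp s h2
    have h4 := hasDerivAt_pi.1 (hasDerivAt_pi.1 h3 x) y
    have h5 : ((-1 : ℝ) • (NormedSpace.exp ((S - s) • L) * L)) x y = -(E s * L) x y := by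
      simp [hE]
    exact h4.congr_deriv h5
  have hg : ∀ s, HasDerivAt (fun s => ∑ y, E s x y * F s y)
      (∑ y, (-(E s * L) x y * F s y + E s x y * F' s y)) s := by
    intro s
    exact HasDerivAt.fun_sum fun y _ => (hEder s y).mul (hF s y)
  have hval : ∀ s, ∑ y, (-(E s * L) x y * F s y + E s x y * F' s y)
      = ∑ y, E s x y * (F' s y - (L *ᵥ F s) y) := by
    intro s
    have h1 : ∑ y, (E s * L) x y * F s y = ∑ y, E s x y * (L *ᵥ F s) y := by
      have := congrFun (Matrix.mulVec_mulVec (F s) (E s) L) x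
      simpa [Matrix.mulVec, dotProduct] using this.symm
    simp only [neg_mul, mul_sub, Finset.sum_add_distrib, Finset.sum_sub_distrib,
      Finset.sum_neg_distrib, h1]
    ring
  have hmono : MonotoneOn (fun s => ∑ y, E s x y * F s y) (Set.Icc 0 S) := by
    refine monotoneOn_of_deriv_nonneg (convex_Icc 0 S)
      (fun s _ => (hg s).continuousAt.continuousWithinAt)
      (fun s _ => (hg s).differentiableAt.differentiableWithinAt) ?_
    intro s hs
    rw [interior_Icc] at hs
    rw [(hg s).deriv, hval]
    refine Finset.sum_nonneg fun y _ => mul_nonneg ?_ (sub_nonneg.2 (hsup s hs.1.le hs.2.le y))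
    refine exp_apply_nonneg (fun a b hab => ?_) x y
    exact mul_nonneg (sub_nonneg.2 hs.2.le) (hL a b hab)
  have h := hmono (Set.left_mem_Icc.2 hS) (Set.right_mem_Icc.2 hS) hS
  have h0 : ∑ y, E 0 x y * F 0 y = (NormedSpace.exp (S • L) *ᵥ F 0) x := by
    simp [hE, Matrix.mulVec, dotProduct]
  have h1 : ∑ y, E S x y * F S y = F S x := by
    simp [hE, Matrix.one_apply]
  rw [← h0, ← h1]
  exact h

theorem exp_map_ofReal (L : Matrix ι ι ℝ) :
    NormedSpace.exp (L.map ((↑) : ℝ → ℂ)) = (NormedSpace.exp L).map ((↑) : ℝ → ℂ) := by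
  have h := NormedSpace.map_exp (f := (Complex.ofRealHom.mapMatrix : Matrix ι ι ℝ →+* Matrix ι ι ℂ))
    (Continuous.matrix_map continuous_id Complex.continuous_ofReal) L
  exact h.symm

end Metzler

/-! ### The trace norm of Hermitian matrices -/

section TraceNorm

variable {n : ℕ}

theorem traceNorm_nonneg (M : Op n) : 0 ≤ traceNorm M :=
  Finset.sum_nonneg fun _ _ => Real.sqrt_nonneg _

theorem traceNorm_eq_sum_abs_eigenvalues {M : Op n} (hM : M.IsHermitian) :
    traceNorm M = ∑ i, |hM.eigenvalues i| := by
  have hch : (Mᴴ * M).charpoly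
      = ∏ i, (Polynomial.X - Polynomial.C (((hM.eigenvalues i) ^ 2 : ℝ) : ℂ)) := by
    have hsq : Mᴴ * M = (Unitary.conjStarAlgAut ℂ (Op n)) hM.eigenvectorUnitary
        (diagonal fun i => (((hM.eigenvalues i) ^ 2 : ℝ) : ℂ)) := by
      rw [hM.eq]
      conv_lhs => rw [hM.spectral_theorem, ← map_mul, diagonal_mul_diagonal]
      congr 2
      funext i
      simp [pow_two]
    rw [hsq, Unitary.conjStarAlgAut_apply, charpoly_mul_comm, ← mul_assoc]
    simp [charpoly_diagonal]
  have hroots := (isHermitian_conjTranspose_mul_self M).roots_charpoly_eq_eigenvalues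
  rw [hch, Polynomial.roots_prod _ _ (Finset.prod_ne_zero_iff.2 fun i _ =>
    Polynomial.X_sub_C_ne_zero _)] at hroots
  simp only [Polynomial.roots_X_sub_C, Multiset.bind_singleton] at hroots
  have h2 := congrArg (fun m : Multiset ℂ => (m.map fun z => Real.sqrt z.re).sum) hroots
  simp only [Multiset.map_map] at h2
  unfold traceNorm
  simp only [Finset.sum]
  convert h2.symm using 3
  · simp
  · rw [Function.comp_apply, Complex.ofReal_re, Real.sqrt_sq_eq_abs]

theorem trace_mul_eq_sum_eigenvalues {M : Op n} (hM : M.IsHermitian) (Q : Op n) :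
    (Q * M).trace = ∑ i, (hM.eigenvalues i : ℂ) *
      ((hM.eigenvectorUnitary : Op n)ᴴ * Q * (hM.eigenvectorUnitary : Op n)) i i := by
  conv_lhs => rw [hM.spectral_theorem, Unitary.conjStarAlgAut_apply]
  rw [← Matrix.mul_assoc, ← Matrix.mul_assoc, Matrix.trace_mul_comm, ← Matrix.mul_assoc,
    ← Matrix.mul_assoc, star_eq_conjTranspose]
  simp [Matrix.trace, Matrix.mul_diagonal, mul_comm]

theorem trace_conj_eigenvectorUnitary {M : Op n} (hM : M.IsHermitian) (Q : Op n) :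
    ((hM.eigenvectorUnitary : Op n)ᴴ * Q * (hM.eigenvectorUnitary : Op n)).trace = Q.trace := by
  rw [Matrix.trace_mul_comm, ← Matrix.mul_assoc, ← star_eq_conjTranspose,
    Unitary.mul_star_self_of_mem hM.eigenvectorUnitary.2, Matrix.one_mul]

theorem eigenvalue_eq_conj_apply {M : Op n} (hM : M.IsHermitian) (i : Bits n) :
    (hM.eigenvalues i : ℂ)
      = ((hM.eigenvectorUnitary : Op n)ᴴ * M * (hM.eigenvectorUnitary : Op n)) i i := by
  have h := hM.conjStarAlgAut_star_eigenvectorUnitary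
  rw [Unitary.conjStarAlgAut_apply] at h
  have h2 := congrFun (congrFun h i) i
  simp [star_eq_conjTranspose] at h2
  exact h2.symm

theorem traceNorm_sub_le_two {ρ σ : Op n} (hρ : IsState ρ) (hσ : IsState σ) :
    traceNorm (ρ - σ) ≤ 2 := by
  have hM : (ρ - σ).IsHermitian := hρ.1.1.sub hσ.1.1
  rw [traceNorm_eq_sum_abs_eigenvalues hM]
  set U : Op n := (hM.eigenvectorUnitary : Op n) with hU
  have hpos : ∀ τ : Op n, τ.PosSemidef → ∀ i, 0 ≤ ((Uᴴ * τ * U) i i).re := fun τ hτ i =>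
    (Complex.le_def.1 ((hτ.conjTranspose_mul_mul_same U).diag_nonneg (i := i))).1
  have htr : ∀ τ : Op n, IsState τ → ∑ i, ((Uᴴ * τ * U) i i).re = 1 := by
    intro τ hτ
    have := trace_conj_eigenvectorUnitary hM τ
    rw [hτ.2, Matrix.trace] at this
    have h2 := congrArg Complex.re this
    simpa using h2
  calc ∑ i, |hM.eigenvalues i|
      ≤ ∑ i, (((Uᴴ * ρ * U) i i).re + ((Uᴴ * σ * U) i i).re) := by
        refine Finset.sum_le_sum fun i _ => ?_
        have h1 := congrArg Complex.re (eigenvalue_eq_conj_apply hM i)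
        rw [Matrix.mul_sub, Matrix.sub_mul] at h1
        simp only [Complex.ofReal_re, Matrix.sub_apply, Complex.sub_re] at h1
        rw [h1, abs_le]
        have := hpos ρ hρ.1 i
        have := hpos σ hσ.1 i
        constructor <;> linarith
    _ = 2 := by
        rw [Finset.sum_add_distrib, htr ρ hρ, htr σ hσ]
        norm_num

/-- The trace norm dominates the expectation of every observable `Q` with `-1 ≤ Q ≤ 1`. -/
theorem re_trace_mul_le_traceNorm {M Q : Op n} (hM : M.IsHermitian)
    (hQ₁ : (1 - Q).PosSemidef) (hQ₂ : (1 + Q).PosSemidef) :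
    (Q * M).trace.re ≤ traceNorm M := by
  rw [traceNorm_eq_sum_abs_eigenvalues hM, trace_mul_eq_sum_eigenvalues hM, Complex.re_sum]
  refine Finset.sum_le_sum fun i _ => ?_
  set U : Op n := (hM.eigenvectorUnitary : Op n) with hU
  have hUU : Uᴴ * U = 1 := by
    rw [← star_eq_conjTranspose]
    exact Unitary.star_mul_self_of_mem hM.eigenvectorUnitary.2
  have h1 := (Complex.le_def.1 ((hQ₁.conjTranspose_mul_mul_same U).diag_nonneg (i := i))).1
  have h2 := (Complex.le_def.1 ((hQ₂.conjTranspose_mul_mul_same U).diag_nonneg (i := i))).1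
  rw [Matrix.mul_sub, Matrix.sub_mul, Matrix.mul_one, hUU] at h1
  rw [Matrix.mul_add, Matrix.add_mul, Matrix.mul_one, hUU] at h2
  simp at h1 h2
  rw [Complex.re_ofReal_mul]
  refine (le_abs_self _).trans ?_
  rw [abs_mul]
  refine mul_le_of_le_one_right (abs_nonneg _) (abs_le.2 ⟨by linarith, by linarith⟩)

end TraceNorm

end GibbsMixing

/-! ### The Hamiltonian in the computational basis -/

namespace GibbsMixing

open Matrix

section Energy

variable {n : ℕ}

/-- The eigenvalue of Pauli `Z` at the basis vector labelled by a bit. -/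
noncomputable def bitSign (b : Fin 2) : ℝ := if b = 0 then 1 else -1

theorem abs_bitSign (b : Fin 2) : |bitSign b| = 1 := by
  unfold bitSign
  split_ifs <;> simp

/-- The eigenvalue of a product of Pauli `Z` operators at the basis vector `x`. -/
noncomputable def zSign (l : List (Fin n)) (x : Bits n) : ℝ := (l.map fun i => bitSign (x i)).prod

theorem abs_zSign (l : List (Fin n)) (x : Bits n) : |zSign l x| = 1 := by
  unfold zSign
  induction l with
  | nil => simp
  | cons i l ih => rw [List.map_cons, List.prod_cons, abs_mul, abs_bitSign, ih, one_mul]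

theorem onSite_pauliZ (i : Fin n) :
    onSite i pauliZ = diagonal fun x : Bits n => (bitSign (x i) : ℂ) := by
  ext x y
  by_cases hxy : x = y
  · subst hxy
    have : ∀ b : Fin 2, pauliZ b b = (bitSign b : ℂ) := by
      intro b
      fin_cases b <;> simp [pauliZ, bitSign]
    simp [onSite, this]
  · rw [diagonal_apply_ne _ hxy]
    unfold onSite
    split_ifs with h
    · have hi : x i ≠ y i := fun hi => hxy (funext fun j => by
        by_cases hj : j = i
        · rw [hj, hi]
        · exact h j hj)
      generalize x i = b at hi
      generalize y i = b' at hi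
      fin_cases b <;> fin_cases b' <;> simp_all [pauliZ]
    · rfl

theorem zString_eq_diagonal (l : List (Fin n)) :
    zString l = diagonal fun x : Bits n => (zSign l x : ℂ) := by
  unfold zString zSign
  induction l with
  | nil => simp
  | cons i l ih =>
    rw [List.map_cons, List.prod_cons, ih, onSite_pauliZ, diagonal_mul_diagonal]
    simp

variable {ι : Type} [Fintype ι]

/-- The classical energy of a bitstring. -/
noncomputable def energy (term : ι → List (Fin n)) (c : ι → ℝ) (x : Bits n) : ℝ :=
  -∑ j, c j * zSign (term j) x

theorem classicalHam_eq_diagonal (term : ι → List (Fin n)) (c : ι → ℝ) :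
    classicalHam term c = diagonal fun x => (energy term c x : ℂ) := by
  ext x y
  by_cases hxy : x = y
  · subst hxy
    simp [classicalHam, energy, zString_eq_diagonal, Matrix.sum_apply]
  · simp [classicalHam, zString_eq_diagonal, Matrix.sum_apply, hxy]

theorem sum_abs_coeff_le_one {term : ι → List (Fin n)} {c : ι → ℝ}
    (hc : ∀ j, (degree term c : ℝ) * |c j| ≤ 1) (i : Fin n) :
    ∑ j, (if i ∈ term j then |c j| else 0) ≤ 1 := by
  classical
  set J : Finset ι := Finset.univ.filter fun j => c j ≠ 0 ∧ i ∈ term j with hJ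
  have hsum : ∑ j, (if i ∈ term j then |c j| else 0) = ∑ j ∈ J, |c j| := by
    rw [hJ, Finset.sum_filter]
    refine Finset.sum_congr rfl fun j _ => ?_
    by_cases h1 : c j = 0 <;> by_cases h2 : i ∈ term j <;> simp [h1, h2]
  have hcard : J.card ≤ degree term c := by
    have h1 : {j : ι | c j ≠ 0 ∧ i ∈ term j}.ncard = J.card := by
      rw [← Set.ncard_coe_finset]
      simp [hJ]
    rw [← h1]
    exact Finset.le_sup (f := fun i : Fin n => {j : ι | c j ≠ 0 ∧ i ∈ term j}.ncard)
      (Finset.mem_univ i)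
  rw [hsum]
  rcases Nat.eq_zero_or_pos (degree term c) with h0 | hpos
  · have : J = ∅ := Finset.card_eq_zero.1 (by omega)
    simp [this]
  · have hdeg : (0 : ℝ) < degree term c := by exact_mod_cast hpos
    have hcard' : (J.card : ℝ) ≤ degree term c := by exact_mod_cast hcard
    have h2 : (degree term c : ℝ) * ∑ j ∈ J, |c j| ≤ degree term c := by
      rw [Finset.mul_sum]
      refine (Finset.sum_le_card_nsmul J _ 1 fun j _ => hc j).trans ?_
      simpa using hcard'
    nlinarith

theorem zSign_congr {l : List (Fin n)} {x y : Bits n} (h : ∀ i ∈ l, x i = y i) :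
    zSign l x = zSign l y := by
  unfold zSign
  congr 1
  exact List.map_congr_left fun i hi => by rw [h i hi]

/-- Flipping one bit changes the energy by at most `2`, since the terms containing that bit have
coefficients of total absolute value at most `1`. -/
theorem energy_sub_energy_le {term : ι → List (Fin n)} {c : ι → ℝ}
    (hc : ∀ j, (degree term c : ℝ) * |c j| ≤ 1) (x y : Bits n) :
    energy term c x - energy term c y ≤ 2 * (hammingDist x y : ℝ) := by
  have hterm : ∀ j, c j * zSign (term j) y - c j * zSign (term j) x
      ≤ ∑ i ∈ Finset.univ.filter (fun i => x i ≠ y i), 2 * (if i ∈ term j then |c j| else 0) := by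
    intro j
    have hnn : ∀ i ∈ Finset.univ.filter (fun i => x i ≠ y i),
        0 ≤ 2 * (if i ∈ term j then |c j| else 0) := by
      intro i _
      split_ifs <;> positivity
    by_cases hj : ∀ i ∈ term j, x i = y i
    · rw [zSign_congr hj, sub_self]
      exact Finset.sum_nonneg hnn
    · push Not at hj
      obtain ⟨i, hi, hxy⟩ := hj
      refine le_trans ?_ (Finset.single_le_sum hnn (Finset.mem_filter.2 ⟨Finset.mem_univ i, hxy⟩))
      rw [if_pos hi]
      have h1 : c j * zSign (term j) y ≤ |c j| := by
        refine (le_abs_self _).trans ?_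
        rw [abs_mul, abs_zSign, mul_one]
      have h2 : -(c j * zSign (term j) x) ≤ |c j| := by
        refine (neg_le_abs _).trans ?_
        rw [abs_mul, abs_zSign, mul_one]
      linarith
  calc energy term c x - energy term c y
      = ∑ j, (c j * zSign (term j) y - c j * zSign (term j) x) := by
        rw [Finset.sum_sub_distrib]
        unfold energy
        ring
    _ ≤ ∑ j, ∑ i ∈ Finset.univ.filter (fun i => x i ≠ y i),
          2 * (if i ∈ term j then |c j| else 0) := Finset.sum_le_sum fun j _ => hterm j
    _ = ∑ i ∈ Finset.univ.filter (fun i => x i ≠ y i),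
          2 * ∑ j, (if i ∈ term j then |c j| else 0) := by
        rw [Finset.sum_comm]
        simp only [Finset.mul_sum]
    _ ≤ ∑ i ∈ Finset.univ.filter (fun i => x i ≠ y i), (2 : ℝ) := by
        refine Finset.sum_le_sum fun i _ => ?_
        have := sum_abs_coeff_le_one hc i
        linarith
    _ = 2 * (hammingDist x y : ℝ) := by
        rw [Finset.sum_const, nsmul_eq_mul, mul_comm]
        rfl

end Energy

section Generator

variable {n : ℕ}

/-- The bitstring `x` with bit `i` flipped. -/
def flipBit (i : Fin n) (x : Bits n) : Bits n := Function.update x i (x i + 1)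

theorem flipBit_flipBit (i : Fin n) (x : Bits n) : flipBit i (flipBit i x) = x := by
  have : ∀ b : Fin 2, b + 1 + 1 = b := by decide
  simp [flipBit, this]

theorem eq_flipBit_comm (i : Fin n) (x y : Bits n) : y = flipBit i x ↔ x = flipBit i y := by
  constructor <;> rintro rfl <;> rw [flipBit_flipBit]

/-- The real matrix of `-H` for `H = E - h ∑ᵢ Xᵢ`, with `E` diagonal in the computational basis. -/
noncomputable def generator (E : Bits n → ℝ) (h : ℝ) : Matrix (Bits n) (Bits n) ℝ :=
  fun x y => (if x = y then -E x else 0) + h * ∑ i, if y = flipBit i x then 1 else 0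

theorem generator_mulVec (E : Bits n → ℝ) (h : ℝ) (F : Bits n → ℝ) (x : Bits n) :
    (generator E h *ᵥ F) x = -E x * F x + h * ∑ i, F (flipBit i x) := by
  simp only [generator, Matrix.mulVec, dotProduct, add_mul, Finset.sum_add_distrib, ite_mul,
    zero_mul, Finset.sum_ite_eq, Finset.mem_univ, if_true, mul_assoc, Finset.sum_mul, one_mul,
    ← Finset.mul_sum]
  rw [Finset.sum_comm]
  simp

theorem generator_apply_nonneg (E : Bits n → ℝ) {h : ℝ} (hh : 0 ≤ h) (x y : Bits n)
    (hxy : x ≠ y) : 0 ≤ generator E h x y := by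
  rw [generator, if_neg hxy, zero_add]
  refine mul_nonneg hh (Finset.sum_nonneg fun i _ => ?_)
  split_ifs <;> norm_num

theorem generator_isSymm (E : Bits n → ℝ) (h : ℝ) : (generator E h).IsSymm := by
  ext x y
  simp only [Matrix.transpose_apply, generator, eq_flipBit_comm _ y x]
  by_cases hxy : x = y
  · simp [hxy]
  · simp [hxy, Ne.symm hxy]

theorem onSite_pauliX_apply (i : Fin n) (x y : Bits n) :
    onSite i pauliX x y = if y = flipBit i x then 1 else 0 := by
  have hX : ∀ b b' : Fin 2, pauliX b b' = if b' = b + 1 then 1 else 0 := by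
    intro b b'
    fin_cases b <;> fin_cases b' <;> simp [pauliX]
  have hiff : y = flipBit i x ↔ (∀ j, j ≠ i → x j = y j) ∧ y i = x i + 1 := by
    constructor
    · rintro rfl
      refine ⟨fun j hj => ?_, ?_⟩ <;> simp [flipBit, *]
    · rintro ⟨h1, h2⟩
      funext j
      by_cases hj : j = i
      · subst hj
        simp [flipBit, h2]
      · simp [flipBit, hj, h1 j hj]
  unfold onSite
  rw [hX]
  by_cases h1 : ∀ j, j ≠ i → x j = y j
  · rw [if_pos h1]
    exact if_congr (by rw [hiff]; exact ⟨fun h => ⟨h1, h⟩, And.right⟩) rfl rfl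
  · rw [if_neg h1, if_neg fun h => h1 (hiff.1 h).1]

theorem neg_transverseHam_eq {ι : Type} [Fintype ι] (term : ι → List (Fin n)) (c : ι → ℝ)
    (h : ℝ) : -transverseHam (classicalHam term c) h
      = (generator (energy term c) h).map ((↑) : ℝ → ℂ) := by
  ext x y
  simp only [transverseHam, classicalHam_eq_diagonal, Matrix.neg_apply, Matrix.sub_apply,
    Matrix.smul_apply, Matrix.sum_apply, onSite_pauliX_apply, Matrix.map_apply, generator,
    diagonal_apply, smul_eq_mul, Complex.ofReal_add, Complex.ofReal_mul, Complex.ofReal_sum,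
    apply_ite Complex.ofReal, Complex.ofReal_neg, Complex.ofReal_zero, Complex.ofReal_one]
  by_cases hxy : x = y
  · simp only [hxy, if_true]
    ring
  · simp only [hxy, if_false]
    ring

/-- The heat kernel `exp (-s H)` of the transverse-field Hamiltonian, a real matrix. -/
noncomputable def heat (E : Bits n → ℝ) (h s : ℝ) : Matrix (Bits n) (Bits n) ℝ :=
  NormedSpace.exp (s • generator E h)

theorem exp_neg_smul_transverseHam {ι : Type} [Fintype ι] (term : ι → List (Fin n)) (c : ι → ℝ)
    (h s : ℝ) : NormedSpace.exp (-((s : ℂ) • transverseHam (classicalHam term c) h))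
      = (heat (energy term c) h s).map ((↑) : ℝ → ℂ) := by
  rw [heat, ← exp_map_ofReal, ← smul_neg, neg_transverseHam_eq]
  congr 1
  ext x y
  simp

theorem exp_neg_smul_classicalHam {ι : Type} [Fintype ι] (term : ι → List (Fin n)) (c : ι → ℝ)
    (s : ℝ) : NormedSpace.exp (-((s : ℂ) • classicalHam term c))
      = diagonal fun x => ((Real.exp (-(s * energy term c x)) : ℝ) : ℂ) := by
  rw [classicalHam_eq_diagonal, ← diagonal_smul, diagonal_neg, Matrix.exp_diagonal]
  congr 1
  funext x
  rw [Pi.coe_exp, ← Complex.exp_eq_exp_ℂ]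
  simp

theorem heat_isSymm (E : Bits n → ℝ) (h s : ℝ) : (heat E h s).IsSymm :=
  ((generator_isSymm E h).smul s).exp

theorem heat_add (E : Bits n → ℝ) (h s t : ℝ) : heat E h (s + t) = heat E h s * heat E h t := by
  rw [heat, add_smul]
  exact Matrix.exp_add_of_commute _ _ (((Commute.refl _).smul_right _).smul_left _)

theorem heat_apply_nonneg (E : Bits n → ℝ) {h s : ℝ} (hh : 0 ≤ h) (hs : 0 ≤ s) (x y : Bits n) :
    0 ≤ heat E h s x y :=
  exp_apply_nonneg (fun a b hab => mul_nonneg hs (generator_apply_nonneg E hh a b hab)) x y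

end Generator

end GibbsMixing

/-! ### Heat kernel estimates -/

namespace GibbsMixing

open Matrix

section HeatBounds

variable {n : ℕ}

theorem hammingDist_flipBit_of_eq {i : Fin n} {x y : Bits n} (h : x i = y i) :
    hammingDist x (flipBit i y) = hammingDist x y + 1 := by
  have hne : ∀ b : Fin 2, b ≠ b + 1 := by decide
  have : Finset.univ.filter (fun j => x j ≠ flipBit i y j)
      = insert i (Finset.univ.filter fun j => x j ≠ y j) := by
    ext j
    rw [Finset.mem_insert, Finset.mem_filter, Finset.mem_filter]
    by_cases hj : j = i
    · subst hj
      simp [flipBit, h, hne]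
    · simp [flipBit, hj]
  unfold hammingDist
  rw [this, Finset.card_insert_of_notMem (by simp [h])]

theorem hammingDist_flipBit_of_ne {i : Fin n} {x y : Bits n} (h : x i ≠ y i) :
    hammingDist x (flipBit i y) + 1 = hammingDist x y := by
  have hxy : x i = flipBit i y i := by
    have : ∀ b b' : Fin 2, b ≠ b' → b = b' + 1 := by decide
    simpa [flipBit] using this _ _ h
  rw [← hammingDist_flipBit_of_eq hxy, flipBit_flipBit]

theorem sum_pow_hammingDist_flipBit_le {θ : ℝ} (hθ : 0 ≤ θ) (x y : Bits n) :
    ∑ i, θ ^ hammingDist x (flipBit i y)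
      ≤ hammingDist x y * θ ^ (hammingDist x y - 1) + n * θ ^ (hammingDist x y + 1) := by
  calc ∑ i, θ ^ hammingDist x (flipBit i y)
      ≤ ∑ i, ((if x i ≠ y i then θ ^ (hammingDist x y - 1) else 0)
          + θ ^ (hammingDist x y + 1)) := by
        refine Finset.sum_le_sum fun i _ => ?_
        have hp : 0 ≤ θ ^ (hammingDist x y + 1) := by positivity
        by_cases hi : x i = y i
        · rw [hammingDist_flipBit_of_eq hi]
          simp [hi]
        · rw [← hammingDist_flipBit_of_ne hi] at hp ⊢
          simpa [hi] using hp
    _ = _ := by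
        rw [Finset.sum_add_distrib, ← Finset.sum_filter, Finset.sum_const, Finset.sum_const,
          nsmul_eq_mul, nsmul_eq_mul, Finset.card_univ, Fintype.card_fin]
        rfl

theorem sum_pow_hammingDist (a : ℝ) (x : Bits n) : ∑ y, a ^ hammingDist x y = (1 + a) ^ n := by
  have h1 : ∀ y : Bits n, a ^ hammingDist x y = ∏ i, if x i ≠ y i then a else 1 := by
    intro y
    rw [Finset.prod_ite, Finset.prod_const, Finset.prod_const_one, mul_one]
    rfl
  have h2 : ∀ b : Fin 2, ∑ b', (if b ≠ b' then a else 1) = 1 + a := by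
    intro b
    fin_cases b <;> simp [Fin.sum_univ_two, add_comm]
  have h3 := Finset.prod_univ_sum (fun _ : Fin n => (Finset.univ : Finset (Fin 2)))
    (fun i b => if x i ≠ b then a else 1)
  simp only [h2, Finset.prod_const, Finset.card_univ, Fintype.card_fin,
    Fintype.piFinset_univ] at h3
  rw [h3]
  exact Finset.sum_congr rfl fun y _ => h1 y

variable {E : Bits n → ℝ} {h : ℝ}

/-- Upper bound for the heat kernel. A path with `k` flips has energy at least `E x - 2 k`
throughout, which amounts to replacing the rate `h` by `h exp (2 S)`. -/
theorem heat_apply_le (hE : ∀ x y, E x - E y ≤ 2 * (hammingDist x y : ℝ)) (hh : 0 ≤ h)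
    {S : ℝ} (hS : 0 ≤ S) (x y : Bits n) :
    heat E h S y x ≤ Real.exp (-S * E x + n * (h * S * Real.exp (2 * S)) ^ 2 / 2)
      * (h * S * Real.exp (2 * S)) ^ hammingDist x y := by
  set θ : ℝ → ℝ := fun s => h * s * Real.exp (2 * s) with hθdef
  set θ' : ℝ → ℝ := fun s => h * (Real.exp (2 * s) + s * (Real.exp (2 * s) * 2)) with hθ'def
  have hθ : ∀ s, HasDerivAt θ (θ' s) s := by
    intro s
    have h1 : HasDerivAt (fun s : ℝ => Real.exp (2 * s)) (Real.exp (2 * s) * 2) s := by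
      simpa using ((hasDerivAt_id s).const_mul 2).exp
    refine (((hasDerivAt_id s).const_mul h).mul h1).congr_deriv ?_
    simp only [hθ'def, id]
    ring
  set W : ℝ → ℝ := fun s => Real.exp (-s * E x + n * θ s ^ 2 / 2) with hWdef
  have hW : ∀ s, HasDerivAt W (W s * (-E x + n * θ s * θ' s)) s := by
    intro s
    have h1 : HasDerivAt (fun s => -s * E x + n * θ s ^ 2 / 2) (-E x + n * θ s * θ' s) s := by
      have h2 := ((hasDerivAt_id s).neg.mul_const (E x)).add
        ((((hθ s).pow 2).const_mul (n : ℝ)).div_const 2)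
      refine h2.congr_deriv ?_
      push_cast
      ring
    exact h1.exp
  set F : ℝ → Bits n → ℝ := fun s y => W s * θ s ^ hammingDist x y with hFdef
  set F' : ℝ → Bits n → ℝ := fun s y => W s * (-E x + n * θ s * θ' s) * θ s ^ hammingDist x y
    + W s * (hammingDist x y * θ s ^ (hammingDist x y - 1) * θ' s) with hF'def
  have hF : ∀ s y, HasDerivAt (fun s => F s y) (F' s y) s := fun s y =>
    (hW s).mul ((hθ s).pow (hammingDist x y))
  have hcomp := exp_smul_mulVec_le_of_supersolution (generator_apply_nonneg E hh) hS hF (by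
    intro s hs _ y
    rw [generator_mulVec]
    set k := hammingDist x y with hk
    have hθs : 0 ≤ θ s := by positivity
    have hWs : 0 ≤ W s := (Real.exp_pos _).le
    have hexp : 1 ≤ Real.exp (2 * s) := Real.one_le_exp (by positivity)
    have hθ1 : h + 2 * θ s ≤ θ' s := by
      simp only [hθdef, hθ'def]
      nlinarith
    have hflip := sum_pow_hammingDist_flipBit_le hθs x y
    have hpow : (k : ℝ) * θ s ^ k = k * θ s ^ (k - 1) * θ s := by
      rcases Nat.eq_zero_or_pos k with h0 | hpos
      · simp [h0]
      · rw [mul_assoc, ← pow_succ, Nat.sub_add_cancel hpos]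
    have hk0 : (0 : ℝ) ≤ k * θ s ^ (k - 1) := by positivity
    have hn0 : (0 : ℝ) ≤ n * θ s ^ (k + 1) := by positivity
    have hEk : (E x - E y) * θ s ^ k ≤ 2 * (k * θ s ^ (k - 1) * θ s) := by
      rw [← hpow, ← mul_assoc]
      exact mul_le_mul_of_nonneg_right (hE x y) (by positivity)
    have hmain : -E y * θ s ^ k + h * ∑ i, θ s ^ hammingDist x (flipBit i y)
        ≤ (-E x + n * θ s * θ' s) * θ s ^ k + k * θ s ^ (k - 1) * θ' s := by
      have h1 := mul_le_mul_of_nonneg_left hflip hh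
      have h2 := mul_le_mul_of_nonneg_left hθ1 hk0
      have h3 : h * (n * θ s ^ (k + 1)) ≤ θ' s * (n * θ s ^ (k + 1)) :=
        mul_le_mul_of_nonneg_right (by linarith) hn0
      rw [← hk] at h1
      have h4 : (n : ℝ) * θ s * θ' s * θ s ^ k = θ' s * (n * θ s ^ (k + 1)) := by ring
      linarith
    have := mul_le_mul_of_nonneg_left hmain hWs
    simp only [hFdef, hF'def, ← hk]
    calc -E y * (W s * θ s ^ k) + h * ∑ i, W s * θ s ^ hammingDist x (flipBit i y)
        = W s * (-E y * θ s ^ k + h * ∑ i, θ s ^ hammingDist x (flipBit i y)) := by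
          rw [← Finset.mul_sum]
          ring
      _ ≤ _ := this
      _ = _ := by ring) y
  have h0 : F 0 = Pi.single x 1 := by
    funext z
    by_cases hz : z = x
    · simp [hFdef, hWdef, hθdef, hz]
    · have hd : hammingDist x z ≠ 0 := hammingDist_ne_zero.2 (Ne.symm hz)
      simp [hFdef, hWdef, hθdef, hz, hd]
  rw [h0, Matrix.mulVec_single_one] at hcomp
  exact hcomp

theorem exp_neg_energy_le_heat_apply (hh : 0 ≤ h) {S : ℝ} (hS : 0 ≤ S) (x : Bits n) :
    Real.exp (-S * E x) ≤ heat E h S x x := by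
  have hW : ∀ s, HasDerivAt (fun s : ℝ => Real.exp (-s * E x)) (Real.exp (-s * E x) * -E x) s := by
    intro s
    have := ((hasDerivAt_id s).neg.mul_const (E x)).exp
    simpa using this
  -- The comparison principle, applied to the negative of a subsolution.
  have hcomp := exp_smul_mulVec_le_of_supersolution (generator_apply_nonneg E hh) hS
    (F := fun s y => Real.exp (-s * E x) * -(Pi.single x 1 : Bits n → ℝ) y)
    (F' := fun s y => Real.exp (-s * E x) * -E x * -(Pi.single x 1 : Bits n → ℝ) y)
    (fun s y => (hW s).mul_const _) (by
      intro s _ _ y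
      rw [generator_mulVec]
      have hsum : ∑ i, Real.exp (-s * E x) * -(Pi.single x 1 : Bits n → ℝ) (flipBit i y) ≤ 0 := by
        refine Finset.sum_nonpos fun i _ => ?_
        refine mul_nonpos_of_nonneg_of_nonpos (Real.exp_pos _).le (neg_nonpos.2 ?_)
        rw [Pi.single_apply]
        split_ifs <;> norm_num
      have := mul_nonpos_of_nonneg_of_nonpos hh hsum
      by_cases hy : y = x
      · subst hy
        simp only [Pi.single_eq_same]
        linarith
      · simp only [Pi.single_eq_of_ne hy] at this ⊢
        linarith) x
  have h0 : (fun y => Real.exp (-0 * E x) * -(Pi.single x 1 : Bits n → ℝ) y)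
      = -(Pi.single x 1) := by
    funext y
    simp
  rw [h0, Matrix.mulVec_neg, Matrix.mulVec_single_one] at hcomp
  simp only [Pi.single_eq_same, mul_neg, mul_one, Pi.neg_apply, neg_le_neg_iff] at hcomp
  exact hcomp

theorem heat_two_mul_apply_self (E : Bits n → ℝ) (h s : ℝ) (x : Bits n) :
    heat E h (2 * s) x x = ∑ y, heat E h s y x ^ 2 := by
  rw [two_mul, heat_add, Matrix.mul_apply]
  refine Finset.sum_congr rfl fun y _ => ?_
  rw [pow_two, (heat_isSymm E h s).apply]

/-- An exponential moment of the number of flips under the squared heat kernel. -/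
theorem sum_exp_mul_heat_sq_le (hE : ∀ x y, E x - E y ≤ 2 * (hammingDist x y : ℝ)) (hh : 0 ≤ h)
    {S : ℝ} (hS : 0 ≤ S) {b : ℝ} (hb : 0 ≤ b) (x : Bits n) :
    ∑ y, b ^ hammingDist x y * heat E h S y x ^ 2
      ≤ Real.exp (-(2 * S) * E x) *
        Real.exp (n * (1 + b) * (h * S * Real.exp (2 * S)) ^ 2) := by
  set θ : ℝ := h * S * Real.exp (2 * S) with hθ
  have hθ0 : 0 ≤ θ := by positivity
  calc ∑ y, b ^ hammingDist x y * heat E h S y x ^ 2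
      ≤ ∑ y, Real.exp (-(2 * S) * E x + n * θ ^ 2) * (b * θ ^ 2) ^ hammingDist x y := by
        refine Finset.sum_le_sum fun y _ => ?_
        have h1 := pow_le_pow_left₀ (heat_apply_nonneg E hh hS y x) (heat_apply_le hE hh hS x y) 2
        refine (mul_le_mul_of_nonneg_left h1 (by positivity)).trans (le_of_eq ?_)
        rw [← hθ, mul_pow (Real.exp _), ← Real.exp_nat_mul, mul_pow b, ← pow_mul, ← pow_mul,
          show ((2 : ℕ) : ℝ) * (-S * E x + n * θ ^ 2 / 2) = -(2 * S) * E x + n * θ ^ 2 by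
            push_cast; ring]
        ring
    _ = Real.exp (-(2 * S) * E x + n * θ ^ 2) * (1 + b * θ ^ 2) ^ n := by
        rw [← Finset.mul_sum, sum_pow_hammingDist]
    _ ≤ Real.exp (-(2 * S) * E x + n * θ ^ 2) * Real.exp (b * θ ^ 2) ^ n := by
        gcongr
        linarith [Real.add_one_le_exp (b * θ ^ 2)]
    _ = _ := by
        rw [← Real.exp_nat_mul, ← Real.exp_add, ← Real.exp_add]
        congr 1
        ring

theorem heat_two_mul_apply_self_le (hE : ∀ x y, E x - E y ≤ 2 * (hammingDist x y : ℝ))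
    (hh : 0 ≤ h) {S : ℝ} (hS : 0 ≤ S) (x : Bits n) :
    heat E h (2 * S) x x ≤ Real.exp (-(2 * S) * E x) *
      Real.exp (n * 2 * (h * S * Real.exp (2 * S)) ^ 2) := by
  have := sum_exp_mul_heat_sq_le hE hh hS zero_le_one x
  simp only [one_pow, one_mul] at this
  rw [heat_two_mul_apply_self]
  norm_num at this ⊢
  exact this

theorem sum_heat_sq_le_of_far (hE : ∀ x y, E x - E y ≤ 2 * (hammingDist x y : ℝ)) (hh : 0 ≤ h)
    {S r : ℝ} (hS : 0 ≤ S) (x : Bits n) (C : Finset (Bits n))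
    (hC : ∀ y ∈ C, r ≤ (hammingDist x y : ℝ)) :
    ∑ y ∈ C, heat E h S y x ^ 2 ≤ Real.exp (-(2 * S) * E x) *
      Real.exp (n * (1 + Real.exp 1) * (h * S * Real.exp (2 * S)) ^ 2 - r) := by
  calc ∑ y ∈ C, heat E h S y x ^ 2
      ≤ ∑ y ∈ C, Real.exp (-r) * (Real.exp 1 ^ hammingDist x y * heat E h S y x ^ 2) := by
        refine Finset.sum_le_sum fun y hy => ?_
        rw [← mul_assoc, ← Real.exp_nat_mul, ← Real.exp_add]
        refine le_mul_of_one_le_left (sq_nonneg _) (Real.one_le_exp ?_)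
        linarith [hC y hy]
    _ ≤ ∑ y, Real.exp (-r) * (Real.exp 1 ^ hammingDist x y * heat E h S y x ^ 2) :=
        Finset.sum_le_sum_of_subset_of_nonneg (Finset.subset_univ _) fun y _ _ => by positivity
    _ ≤ Real.exp (-r) * (Real.exp (-(2 * S) * E x) *
          Real.exp (n * (1 + Real.exp 1) * (h * S * Real.exp (2 * S)) ^ 2)) := by
        rw [← Finset.mul_sum]
        exact mul_le_mul_of_nonneg_left (sum_exp_mul_heat_sq_le hE hh hS (Real.exp_pos 1).le x)
          (Real.exp_pos _).le
    _ = _ := by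
        rw [sub_eq_add_neg, Real.exp_add _ (-r)]
        ring

end HeatBounds

end GibbsMixing

/-! ### Local channels and the bottleneck argument -/

namespace GibbsMixing

open Matrix

section Bottleneck

variable {n : ℕ}

/-- The projector onto the span of the computational basis vectors labelled by `A`. -/
noncomputable def regionProj (A : Finset (Bits n)) : Op n := diagonal fun x => if x ∈ A then 1 else 0

/-- The weight `Tr (P_A M)` of an operator `M` on a region `A` of the computational basis; its real
part, which is the whole trace when `M` is Hermitian. -/
noncomputable def mass (A : Finset (Bits n)) (M : Op n) : ℝ := ∑ x ∈ A, (M x x).re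

theorem re_trace_regionProj_mul (A : Finset (Bits n)) (M : Op n) :
    (regionProj A * M).trace.re = mass A M := by
  simp [regionProj, mass, Matrix.trace, Matrix.diagonal_mul, Finset.sum_ite_mem]

theorem mass_sub (A : Finset (Bits n)) (M N : Op n) : mass A (M - N) = mass A M - mass A N := by
  simp [mass]

theorem mass_smul (A : Finset (Bits n)) (q : ℝ) (M : Op n) :
    mass A ((q : ℂ) • M) = q * mass A M := by
  simp [mass, Finset.mul_sum]

theorem mass_union {A C : Finset (Bits n)} (h : Disjoint A C) (M : Op n) :
    mass (A ∪ C) M = mass A M + mass C M :=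
  Finset.sum_union h

theorem mass_compl (A : Finset (Bits n)) (M : Op n) : mass Aᶜ M = M.trace.re - mass A M := by
  rw [eq_sub_iff_add_eq, mass, mass, Finset.sum_compl_add_sum]
  simp [Matrix.trace]

theorem mass_nonneg (A : Finset (Bits n)) {M : Op n} (hM : M.PosSemidef) : 0 ≤ mass A M :=
  Finset.sum_nonneg fun _ _ => (Complex.le_def.1 hM.diag_nonneg).1

theorem mass_le_of_posSemidef_sub (A : Finset (Bits n)) {M N : Op n} (h : (N - M).PosSemidef) :
    mass A M ≤ mass A N := by
  have := mass_nonneg A h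
  rw [mass_sub] at this
  linarith

theorem one_sub_regionProj (A : Finset (Bits n)) : 1 - regionProj A = regionProj Aᶜ := by
  rw [regionProj, regionProj, ← diagonal_one, diagonal_sub]
  congr 1
  funext x
  by_cases h : x ∈ A <;> simp [h]

theorem regionProj_posSemidef (A : Finset (Bits n)) : (regionProj A).PosSemidef := by
  refine PosSemidef.diagonal fun x => ?_
  dsimp only
  split_ifs <;> simp

theorem regionProj_conjTranspose (A : Finset (Bits n)) : (regionProj A)ᴴ = regionProj A :=
  (regionProj_posSemidef A).1

theorem regionProj_mul_self (A : Finset (Bits n)) :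
    regionProj A * regionProj A = regionProj A := by
  rw [regionProj, diagonal_mul_diagonal]
  congr 1
  funext x
  by_cases h : x ∈ A <;> simp [h]

theorem IsDiagProj.exists_eq_regionProj {P : Op n} (hP : IsDiagProj P) :
    ∃ A : Finset (Bits n), P = regionProj A ∧ ∀ x ∈ A, P x x ≠ 0 := by
  classical
  have hdiag : P = diagonal fun x => P x x := by
    ext x y
    by_cases hxy : x = y
    · subst hxy
      simp
    · rw [diagonal_apply_ne _ hxy]
      exact hP.2 hxy
  have hsq : ∀ x, P x x * P x x = P x x := by
    intro x
    have h1 : P * P = P := hP.1.isIdempotentElem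
    rw [hdiag, diagonal_mul_diagonal] at h1
    simpa using congrFun (congrFun h1 x) x
  refine ⟨Finset.univ.filter fun x => P x x ≠ 0, ?_, fun x hx => (Finset.mem_filter.1 hx).2⟩
  rw [regionProj]
  conv_lhs => rw [hdiag]
  congr 1
  funext x
  by_cases h : P x x = 0
  · simp [h]
  · have : P x x = 1 := mul_left_cancel₀ h (by rw [hsq, mul_one])
    simp [this]

theorem IsLocalOp.apply_eq_zero {l : ℕ} {K : Op n} (hK : IsLocalOp l K) {x y : Bits n}
    (h : l < hammingDist x y) : K x y = 0 := by
  obtain ⟨S, hS, M, hM⟩ := hK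
  rw [hM, if_neg]
  intro hxy
  have hsub : (Finset.univ.filter fun i => x i ≠ y i) ⊆ S := by
    intro i hi
    by_contra hiS
    exact (Finset.mem_filter.1 hi).2 (hxy i hiS)
  have h1 : hammingDist x y ≤ S.card := Finset.card_le_card hsub
  omega

theorem IsLocalOp.regionProj_mul_mul_eq_zero {l : ℕ} {K : Op n} (hK : IsLocalOp l K)
    {A C : Finset (Bits n)} (h : ∀ x ∈ A, ∀ y ∈ C, l < hammingDist x y) :
    regionProj A * K * regionProj C = 0 := by
  ext x y
  rw [regionProj, regionProj, mul_diagonal, diagonal_mul]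
  by_cases hx : x ∈ A <;> by_cases hy : y ∈ C <;> simp [hx, hy]
  exact hK.apply_eq_zero (h x hx y hy)

theorem IsChannel.map_posSemidef {T : SuperOp n} (hT : IsChannel T) {ρ : Op n}
    (hρ : ρ.PosSemidef) : (T ρ).PosSemidef :=
  (hT.completelyPositive 1 (ρ.submatrix Prod.fst Prod.fst) (hρ.submatrix Prod.fst)).submatrix
    fun x => (x, 0)

/-- A local channel moves weight onto `C` only from outside the distant region `A`: the
Heisenberg-picture observable of `C` is at most `1` and lives on the complement of `A`. -/
theorem mass_map_le {T : SuperOp n} (hT : IsChannel T) {l : ℕ} (hl : IsLocalMap l T)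
    {A C : Finset (Bits n)} (hAC : ∀ x ∈ A, ∀ y ∈ C, l < hammingDist x y) {τ : Op n}
    (hτ : τ.PosSemidef) : mass C (T τ) ≤ mass Aᶜ τ := by
  obtain ⟨r, K, K', hK, hK', hTK⟩ := hl
  have hCA : ∀ y ∈ C, ∀ x ∈ A, l < hammingDist y x := fun y hy x hx => by
    rw [hammingDist_comm]
    exact hAC x hx y hy
  set P := regionProj A with hP
  set Q := regionProj Aᶜ with hQ
  have hPQ : Q = 1 - P := (one_sub_regionProj A).symm
  have hleft : ∀ M : Op n, (regionProj C * T (P * M)).trace = 0 := by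
    intro M
    have : ∀ j, regionProj C * (K j * (P * M) * K' j) = 0 := by
      intro j
      have h1 := (hK j).regionProj_mul_mul_eq_zero hCA
      calc regionProj C * (K j * (P * M) * K' j)
          = (regionProj C * K j * P) * M * K' j := by simp only [Matrix.mul_assoc]
        _ = 0 := by rw [h1]; simp
    simp [hTK, Finset.mul_sum, this]
  have hright : ∀ M : Op n, (regionProj C * T (M * P)).trace = 0 := by
    intro M
    have : ∀ j, K j * (M * P) * K' j * regionProj C = 0 := by
      intro j
      have h1 := (hK' j).regionProj_mul_mul_eq_zero hAC
      calc K j * (M * P) * K' j * regionProj C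
          = K j * M * (P * K' j * regionProj C) := by simp only [Matrix.mul_assoc]
        _ = 0 := by rw [h1]; simp
    rw [Matrix.trace_mul_comm]
    simp [hTK, Finset.sum_mul, this]
  have hsplit : τ = Q * τ * Q + P * (τ * Q) + τ * P := by
    rw [hPQ]
    noncomm_ring
  have hQτ : (Q * τ * Q).PosSemidef := by
    have := hτ.mul_mul_conjTranspose_same Q
    rwa [regionProj_conjTranspose] at this
  have h1 : mass C (T τ) = mass C (T (Q * τ * Q)) := by
    rw [← re_trace_regionProj_mul, ← re_trace_regionProj_mul]
    conv_lhs => rw [hsplit]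
    rw [map_add, map_add, Matrix.mul_add, Matrix.mul_add, Matrix.trace_add, Matrix.trace_add,
      hleft, hright, add_zero, add_zero]
  have h2 := mass_nonneg Cᶜ (hT.map_posSemidef hQτ)
  rw [mass_compl, hT.tracePreserving, Matrix.trace_mul_comm, ← Matrix.mul_assoc,
    regionProj_mul_self, re_trace_regionProj_mul] at h2
  rw [h1]
  linarith

/-- A state dominated by a multiple of the fixed point `G` stays so under iteration, hence its
weight on the bottleneck `(A ∪ C)ᶜ` stays small and it leaks into `C` only at that rate. -/
theorem mass_iterate_le {T : SuperOp n} (hT : IsChannel T) {l : ℕ} (hl : IsLocalMap l T)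
    {A C : Finset (Bits n)} (hAC : ∀ x ∈ A, ∀ y ∈ C, l < hammingDist x y) (hdisj : Disjoint A C)
    {G : Op n} (hG : T G = G) {q : ℝ} {τ : Op n} (hτ : τ.PosSemidef)
    (hτG : ((q : ℂ) • G - τ).PosSemidef) (t : ℕ) :
    ((T ^ t) τ).PosSemidef ∧ ((T ^ t) τ).trace = τ.trace ∧
      mass (A ∪ C)ᶜ ((T ^ t) τ) ≤ q * mass (A ∪ C)ᶜ G ∧
      mass C ((T ^ t) τ) ≤ mass C τ + t * (q * mass (A ∪ C)ᶜ G) := by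
  suffices h : ((T ^ t) τ).PosSemidef ∧ ((T ^ t) τ).trace = τ.trace ∧
      ((q : ℂ) • G - (T ^ t) τ).PosSemidef ∧
      mass C ((T ^ t) τ) ≤ mass C τ + t * (q * mass (A ∪ C)ᶜ G) by
    obtain ⟨h1, h2, h3, h4⟩ := h
    refine ⟨h1, h2, ?_, h4⟩
    rw [← mass_smul]
    exact mass_le_of_posSemidef_sub _ h3
  induction t with
  | zero => simpa using ⟨hτ, hτG⟩
  | succ t ih =>
    obtain ⟨h1, h2, h3, h4⟩ := ih
    rw [pow_succ', Module.End.mul_apply]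
    refine ⟨hT.map_posSemidef h1, by rw [hT.tracePreserving, h2], ?_, ?_⟩
    · have := hT.map_posSemidef h3
      rwa [map_sub, map_smul, hG] at this
    · have h5 := mass_map_le hT hl hAC h1
      have h6 := mass_le_of_posSemidef_sub (A ∪ C)ᶜ h3
      rw [mass_smul] at h6
      rw [mass_compl] at h5
      rw [mass_compl, mass_union hdisj] at h6
      push_cast
      linarith

/-- If two states, one near `A` and one near `C`, are dominated by a multiple of the fixed point,
then the time needed to contract their distance by a factor `2` is bounded below by the inverse
weight of the bottleneck. -/
theorem half_le_of_contraction {T : SuperOp n} (hT : IsChannel T) {l : ℕ} (hl : IsLocalMap l T)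
    {A C : Finset (Bits n)} (hAC : ∀ x ∈ A, ∀ y ∈ C, l < hammingDist x y) (hdisj : Disjoint A C)
    {G : Op n} (hG : T G = G) {q δ η : ℝ} {ρ σ : Op n} (hρ : IsState ρ) (hσ : IsState σ)
    (hρG : ((q : ℂ) • G - ρ).PosSemidef) (hσG : ((q : ℂ) • G - σ).PosSemidef)
    (hρC : mass C ρ ≤ δ) (hσA : mass A σ ≤ δ) (hη : q * mass (A ∪ C)ᶜ G ≤ η) (t : ℕ)
    (ht : traceNorm ((T ^ t) (ρ - σ)) ≤ 1 / 2 * traceNorm (ρ - σ)) :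
    1 / 2 ≤ 2 * δ + (2 * t + 1) * η := by
  have hCA : ∀ y ∈ C, ∀ x ∈ A, l < hammingDist y x := fun y hy x hx => by
    rw [hammingDist_comm]
    exact hAC x hx y hy
  obtain ⟨p1, p2, -, p4⟩ := mass_iterate_le hT hl hAC hdisj hG hρ.1 hρG t
  obtain ⟨s1, s2, s3, s4⟩ := mass_iterate_le hT hl hCA hdisj.symm hG hσ.1 hσG t
  rw [Finset.union_comm] at s3 s4
  have hM : ((T ^ t) (ρ - σ)).IsHermitian := by
    rw [map_sub]
    exact p1.1.sub s1.1
  have hQ₁ : (1 - (1 - (2 : ℂ) • regionProj C)).PosSemidef := by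
    rw [sub_sub_cancel]
    exact (regionProj_posSemidef C).smul (by norm_num)
  have hQ₂ : (1 + (1 - (2 : ℂ) • regionProj C)).PosSemidef := by
    have h1 : (1 : Op n) + (1 - (2 : ℂ) • regionProj C) = (2 : ℂ) • regionProj Cᶜ := by
      rw [← one_sub_regionProj, smul_sub, two_smul ℂ (1 : Op n)]
      abel
    rw [h1]
    exact (regionProj_posSemidef Cᶜ).smul (by norm_num)
  have h1 := re_trace_mul_le_traceNorm hM hQ₁ hQ₂
  have h2 := traceNorm_sub_le_two hρ hσ
  have h3 : ((1 - (2 : ℂ) • regionProj C) * (T ^ t) (ρ - σ)).trace.re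
      = 2 * (mass C ((T ^ t) σ) - mass C ((T ^ t) ρ)) := by
    rw [Matrix.sub_mul, Matrix.one_mul, Matrix.smul_mul, Matrix.trace_sub, Matrix.trace_smul,
      map_sub, Matrix.trace_sub, p2, s2, hρ.2, hσ.2, sub_self, zero_sub, smul_eq_mul,
      Complex.neg_re, show (2 : ℂ) = ((2 : ℝ) : ℂ) by norm_num, Complex.re_ofReal_mul,
      re_trace_regionProj_mul, mass_sub]
    ring
  rw [mass_compl, mass_union hdisj, s2, hσ.2, Complex.one_re] at s3
  have htη : (t : ℝ) * (q * mass (A ∪ C)ᶜ G) ≤ t * η :=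
    mul_le_mul_of_nonneg_left hη (Nat.cast_nonneg t)
  linarith

/-- The state `√G P_A √G / Tr (P_A G)` for `G = R * R`, with the real symmetric matrix `R` in the
role of `√G`; it is dominated by a multiple of `G`. -/
noncomputable def restrictedState (R : Matrix (Bits n) (Bits n) ℝ) (A : Finset (Bits n)) : Op n :=
  (((∑ x ∈ A, (R * R) x x)⁻¹ : ℝ) : ℂ) •
    (R.map ((↑) : ℝ → ℂ) * regionProj A * R.map ((↑) : ℝ → ℂ))

theorem isHermitian_map_ofReal {R : Matrix (Bits n) (Bits n) ℝ} (hR : R.IsSymm) :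
    (R.map ((↑) : ℝ → ℂ)).IsHermitian := by
  ext x y
  simp [hR.apply]

theorem map_ofReal_mul_regionProj_mul_apply_self {R : Matrix (Bits n) (Bits n) ℝ} (hR : R.IsSymm)
    (A : Finset (Bits n)) (y : Bits n) :
    (R.map ((↑) : ℝ → ℂ) * regionProj A * R.map ((↑) : ℝ → ℂ)) y y
      = ((∑ x ∈ A, R y x ^ 2 : ℝ) : ℂ) := by
  rw [Matrix.mul_apply]
  simp only [regionProj, mul_diagonal, Matrix.map_apply, mul_ite, mul_one, mul_zero, ite_mul,
    zero_mul, Finset.sum_ite_mem, Finset.univ_inter]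
  push_cast
  refine Finset.sum_congr rfl fun x _ => ?_
  rw [← hR.apply x y, pow_two]

theorem mul_self_apply_self {R : Matrix (Bits n) (Bits n) ℝ} (hR : R.IsSymm) (x : Bits n) :
    (R * R) x x = ∑ y, R y x ^ 2 := by
  rw [Matrix.mul_apply]
  refine Finset.sum_congr rfl fun y _ => ?_
  rw [hR.apply y x, pow_two]

theorem isState_restrictedState {R : Matrix (Bits n) (Bits n) ℝ} (hR : R.IsSymm)
    {A : Finset (Bits n)} (hA : 0 < ∑ x ∈ A, (R * R) x x) : IsState (restrictedState R A) := by
  constructor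
  · have h1 := (regionProj_posSemidef A).mul_mul_conjTranspose_same (R.map ((↑) : ℝ → ℂ))
    rw [(isHermitian_map_ofReal hR).eq] at h1
    exact h1.smul (Complex.zero_le_real.2 (inv_nonneg.2 hA.le))
  · rw [restrictedState, Matrix.trace_smul, Matrix.trace]
    simp only [Matrix.diag_apply, map_ofReal_mul_regionProj_mul_apply_self hR]
    rw [← Complex.ofReal_sum, Finset.sum_comm, smul_eq_mul, ← Complex.ofReal_mul]
    simp only [← mul_self_apply_self hR]
    rw [inv_mul_cancel₀ hA.ne', Complex.ofReal_one]

theorem posSemidef_smul_sub_restrictedState {R : Matrix (Bits n) (Bits n) ℝ} (hR : R.IsSymm)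
    {A : Finset (Bits n)} (hA : 0 < ∑ x ∈ A, (R * R) x x) {q : ℝ}
    (hq : (∑ x ∈ A, (R * R) x x)⁻¹ ≤ q) :
    ((q : ℂ) • (R * R).map ((↑) : ℝ → ℂ) - restrictedState R A).PosSemidef := by
  set p := (∑ x ∈ A, (R * R) x x)⁻¹ with hp
  set Rc : Op n := R.map ((↑) : ℝ → ℂ) with hRc
  have hmap : (R * R).map ((↑) : ℝ → ℂ) = Rc * Rc :=
    Matrix.map_mul (f := Complex.ofRealHom)
  have hdecomp : (q : ℂ) • (R * R).map ((↑) : ℝ → ℂ) - restrictedState R A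
      = ((q - p : ℝ) : ℂ) • (Rc * 1 * Rcᴴ) + (p : ℂ) • (Rc * regionProj Aᶜ * Rcᴴ) := by
    rw [hmap, restrictedState, (isHermitian_map_ofReal hR).eq, ← one_sub_regionProj,
      Matrix.mul_sub, Matrix.sub_mul, smul_sub, Complex.ofReal_sub, sub_smul, Matrix.mul_one]
    abel
  rw [hdecomp]
  refine PosSemidef.add ?_ ?_
  · exact (PosSemidef.one.mul_mul_conjTranspose_same Rc).smul
      (Complex.zero_le_real.2 (sub_nonneg.2 hq))
  · exact ((regionProj_posSemidef Aᶜ).mul_mul_conjTranspose_same Rc).smul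
      (Complex.zero_le_real.2 (inv_nonneg.2 hA.le))

theorem mass_restrictedState {R : Matrix (Bits n) (Bits n) ℝ} (hR : R.IsSymm)
    (A C : Finset (Bits n)) : mass C (restrictedState R A)
      = (∑ x ∈ A, (R * R) x x)⁻¹ * ∑ x ∈ A, ∑ y ∈ C, R y x ^ 2 := by
  rw [restrictedState, mass_smul, mass, Finset.sum_comm]
  congr 1
  refine Finset.sum_congr rfl fun y _ => ?_
  rw [map_ofReal_mul_regionProj_mul_apply_self hR, Complex.ofReal_re]

end Bottleneck

end GibbsMixing

/-! ### Gibbs weights and the choice of constants -/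

namespace GibbsMixing

open Matrix

section Constants

variable {n : ℕ}

theorem mass_gibbs_classicalHam {ι : Type} [Fintype ι] (term : ι → List (Fin n)) (c : ι → ℝ)
    (β : ℝ) (A : Finset (Bits n)) : mass A (gibbs β (classicalHam term c))
      = (∑ x, Real.exp (-β * energy term c x))⁻¹ * ∑ x ∈ A, Real.exp (-β * energy term c x) := by
  rw [gibbs, exp_neg_smul_classicalHam, Matrix.trace_diagonal, ← Complex.ofReal_sum,
    ← Complex.ofReal_inv, mass_smul, mass]
  simp only [diagonal_apply_eq, Complex.ofReal_re, neg_mul]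

theorem one_sub_regionProj_sub_regionProj {A C : Finset (Bits n)} (h : Disjoint A C) :
    1 - regionProj A - regionProj C = regionProj (A ∪ C)ᶜ := by
  rw [← one_sub_regionProj, sub_sub]
  congr 1
  rw [regionProj, regionProj, regionProj, diagonal_add]
  congr 1
  funext x
  by_cases hA : x ∈ A
  · simp [hA, Finset.disjoint_left.1 h hA]
  · by_cases hC : x ∈ C <;> simp [hA, hC]

theorem map_heat_eq_of_map_gibbs_eq {ι : Type} [Fintype ι] {term : ι → List (Fin n)} {c : ι → ℝ}
    {β h : ℝ} (hβ : 0 ≤ β) (hh : 0 ≤ h) {T : SuperOp n}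
    (hT : T (gibbs β (transverseHam (classicalHam term c) h))
      = gibbs β (transverseHam (classicalHam term c) h)) :
    T ((heat (energy term c) h β).map ((↑) : ℝ → ℂ))
      = (heat (energy term c) h β).map ((↑) : ℝ → ℂ) := by
  have hZ : 0 < ∑ x, heat (energy term c) h β x x :=
    Finset.sum_pos (fun x _ => (Real.exp_pos _).trans_le (exp_neg_energy_le_heat_apply hh hβ x))
      Finset.univ_nonempty
  have htr : ((heat (energy term c) h β).map ((↑) : ℝ → ℂ)).trace ≠ 0 := by
    have : ((heat (energy term c) h β).map ((↑) : ℝ → ℂ)).trace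
        = ((∑ x, heat (energy term c) h β x x : ℝ) : ℂ) := by
      simp [Matrix.trace]
    rw [this]
    exact_mod_cast hZ.ne'
  rw [gibbs, exp_neg_smul_transverseHam, map_smul] at hT
  exact smul_right_injective _ (inv_ne_zero htr) hT

/-- Fixed-size form of the lower bound on the contraction time. Here `θ` bounds the amplitude
for flipping a given site within imaginary time `β / 2`; the hypothesis `hθa` keeps the bottleneck
weight small and `hθd` suppresses tunnelling between `A` and `C`. -/
theorem half_le_of_gibbs_contraction {ι : Type} [Fintype ι] {term : ι → List (Fin n)} {c : ι → ℝ}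
    (hc : ∀ j, (degree term c : ℝ) * |c j| ≤ 1) {β a d w h θ : ℝ} (hβ : 0 < β) (hw : 0 < w)
    (hh : 0 ≤ h) (hθ : θ = h * (β / 2) * Real.exp (2 * (β / 2))) (hθa : 2 * θ ^ 2 ≤ a / 6)
    (hθd : (1 + Real.exp 1) * θ ^ 2 ≤ 3 / 4 * d) {A C : Finset (Bits n)}
    (hsep : ∀ x ∈ A, ∀ y ∈ C, d * n < (hammingDist x y : ℝ)) (hdisj : Disjoint A C)
    (hA : w ≤ mass A (gibbs β (classicalHam term c)))
    (hC : w ≤ mass C (gibbs β (classicalHam term c)))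
    (hB : mass (A ∪ C)ᶜ (gibbs β (classicalHam term c)) ≤ Real.exp (-(a * n)))
    {l : ℕ} (hl : (l : ℝ) < d * n) {T : SuperOp n}
    (hT : IsLocalGibbsSampler l (gibbs β (transverseHam (classicalHam term c) h)) T) {t : ℕ}
    (ht : ∀ ρ σ : Op n, IsState ρ → IsState σ →
      traceNorm ((T ^ t) (ρ - σ)) ≤ 1 / 2 * traceNorm (ρ - σ)) :
    1 / 2 ≤ 2 * Real.exp (-(d * n / 4)) + (2 * t + 1) * (Real.exp (-(5 / 6 * a * n)) / w) := by
  obtain ⟨hch, hloc, hfix⟩ := hT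
  set E := energy term c with hEdef
  have hE : ∀ x y, E x - E y ≤ 2 * (hammingDist x y : ℝ) := energy_sub_energy_le hc
  set Z := ∑ x, Real.exp (-β * E x) with hZdef
  have hZ : 0 < Z := Finset.sum_pos (fun x _ => Real.exp_pos _) Finset.univ_nonempty
  set R := heat E h (β / 2) with hR
  have hβ2 : 0 ≤ β / 2 := by positivity
  have hββ : 2 * (β / 2) = β := by ring
  have hRs : R.IsSymm := heat_isSymm E h _
  have hRR : R * R = heat E h β := by
    rw [hR, ← heat_add, add_halves]
  -- Both regions keep at least their classical weight.
  have hwt : ∀ D : Finset (Bits n), w ≤ mass D (gibbs β (classicalHam term c)) →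
      w * Z ≤ ∑ x ∈ D, (R * R) x x ∧
        ∑ x ∈ D, Real.exp (-β * E x) ≤ ∑ x ∈ D, (R * R) x x := by
    intro D hD
    have h1 : ∑ x ∈ D, Real.exp (-β * E x) ≤ ∑ x ∈ D, (R * R) x x := by
      rw [hRR]
      exact Finset.sum_le_sum fun x _ => exp_neg_energy_le_heat_apply hh hβ.le x
    rw [mass_gibbs_classicalHam, inv_mul_eq_div, le_div_iff₀ hZ] at hD
    exact ⟨hD.trans h1, h1⟩
  have hwZ : 0 < w * Z := mul_pos hw hZ
  have hposA := hwZ.trans_le (hwt A hA).1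
  have hposC := hwZ.trans_le (hwt C hC).1
  have htunnel : ∀ D D' : Finset (Bits n), w ≤ mass D (gibbs β (classicalHam term c)) →
      (∀ x ∈ D, ∀ y ∈ D', d * n < (hammingDist x y : ℝ)) →
      mass D' (restrictedState R D) ≤ Real.exp (-(d * n / 4)) := by
    intro D D' hD hDD'
    have hpos := hwZ.trans_le (hwt D hD).1
    rw [mass_restrictedState hRs, inv_mul_eq_div, div_le_iff₀ hpos]
    calc ∑ x ∈ D, ∑ y ∈ D', R y x ^ 2
        ≤ ∑ x ∈ D, Real.exp (-β * E x) * Real.exp (-(d * n / 4)) := by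
          refine Finset.sum_le_sum fun x hx => ?_
          have h1 := sum_heat_sq_le_of_far hE hh hβ2 x D' fun y hy => (hDD' x hx y hy).le
          rw [← hθ, hββ] at h1
          refine h1.trans (mul_le_mul_of_nonneg_left (Real.exp_le_exp.2 ?_) (Real.exp_pos _).le)
          have := mul_le_mul_of_nonneg_left hθd (Nat.cast_nonneg (α := ℝ) n)
          linarith
      _ = Real.exp (-(d * n / 4)) * ∑ x ∈ D, Real.exp (-β * E x) := by
          rw [← Finset.sum_mul, mul_comm]
      _ ≤ _ := mul_le_mul_of_nonneg_left (hwt D hD).2 (Real.exp_pos _).le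
  have hbottleneck : (w * Z)⁻¹ * mass (A ∪ C)ᶜ ((R * R).map ((↑) : ℝ → ℂ))
      ≤ Real.exp (-(5 / 6 * a * n)) / w := by
    rw [mass_gibbs_classicalHam, inv_mul_eq_div, div_le_iff₀ hZ] at hB
    rw [inv_mul_eq_div, div_le_div_iff₀ hwZ hw]
    calc mass (A ∪ C)ᶜ ((R * R).map ((↑) : ℝ → ℂ)) * w
        ≤ (∑ x ∈ (A ∪ C)ᶜ, Real.exp (-β * E x) * Real.exp (a / 6 * n)) * w := by
          refine mul_le_mul_of_nonneg_right (Finset.sum_le_sum fun x _ => ?_) hw.le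
          have h1 := heat_two_mul_apply_self_le hE hh hβ2 x
          rw [← hθ, hββ] at h1
          rw [hRR, Matrix.map_apply, Complex.ofReal_re]
          refine h1.trans (mul_le_mul_of_nonneg_left (Real.exp_le_exp.2 ?_) (Real.exp_pos _).le)
          have := mul_le_mul_of_nonneg_left hθa (Nat.cast_nonneg (α := ℝ) n)
          linarith
      _ ≤ (Real.exp (-(a * n)) * Z) * Real.exp (a / 6 * n) * w := by
          rw [← Finset.sum_mul]
          gcongr
      _ = Real.exp (-(5 / 6 * a * n)) * (w * Z) := by
          rw [show -(5 / 6 * a * n) = -(a * n) + a / 6 * n by ring, Real.exp_add]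
          ring
  have hlsep : ∀ x ∈ A, ∀ y ∈ C, l < hammingDist x y := fun x hx y hy => by
    exact_mod_cast hl.trans (hsep x hx y hy)
  have hfix' : T ((R * R).map ((↑) : ℝ → ℂ)) = (R * R).map ((↑) : ℝ → ℂ) := by
    rw [hRR]
    exact map_heat_eq_of_map_gibbs_eq hβ.le hh hfix
  have hsA := isState_restrictedState hRs hposA
  have hsC := isState_restrictedState hRs hposC
  exact half_le_of_contraction hch hloc hlsep hdisj hfix' hsA hsC
    (posSemidef_smul_sub_restrictedState hRs hposA (inv_anti₀ hwZ (hwt A hA).1))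
    (posSemidef_smul_sub_restrictedState hRs hposC (inv_anti₀ hwZ (hwt C hC).1))
    (htunnel A C hA hsep)
    (htunnel C A hC fun x hx y hy => by rw [hammingDist_comm]; exact hsep y hy x hx)
    hbottleneck t (ht _ _ hsA hsC)

theorem two_mul_flip_rate_sq_le {β a h : ℝ} (hβ : 0 < β) (ha : 0 < a) (hh : 0 ≤ h)
    (hha : h < Real.sqrt a / (Real.sqrt 3 * β) * Real.exp (-β)) :
    2 * (h * (β / 2) * Real.exp (2 * (β / 2))) ^ 2 ≤ a / 6 := by
  have h3 : 0 < Real.sqrt 3 := Real.sqrt_pos.2 (by norm_num)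
  have h1 : h * (β / 2) * Real.exp (2 * (β / 2)) ≤ Real.sqrt a / (2 * Real.sqrt 3) := by
    calc h * (β / 2) * Real.exp (2 * (β / 2))
        ≤ Real.sqrt a / (Real.sqrt 3 * β) * Real.exp (-β) * (β / 2) * Real.exp (2 * (β / 2)) := by
          gcongr
      _ = Real.sqrt a / (2 * Real.sqrt 3) * (Real.exp (-β) * Real.exp (2 * (β / 2))) := by
          field_simp
      _ = Real.sqrt a / (2 * Real.sqrt 3) := by
          rw [← Real.exp_add, show -β + 2 * (β / 2) = 0 by ring, Real.exp_zero, mul_one]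
  have h2 := pow_le_pow_left₀ (by positivity) h1 2
  rw [div_pow, mul_pow 2, Real.sq_sqrt ha.le, Real.sq_sqrt (by norm_num)] at h2
  linarith

theorem one_add_exp_mul_flip_rate_sq_le {β d h : ℝ} (hβ : 0 < β) (hd : 0 < d) (hd1 : d ≤ 1)
    (hh : 0 ≤ h) (hhd : h < Real.exp (-(3 * β / (2 * d)))) :
    (1 + Real.exp 1) * (h * (β / 2) * Real.exp (2 * (β / 2))) ^ 2 ≤ 3 / 4 * d := by
  set u := β / (2 * d) with hu
  have hβu : β = 2 * d * u := by
    rw [hu]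
    field_simp
  have hu0 : 0 < u := by positivity
  -- `u exp (-u)` is maximal at `u = 1`.
  have hue : u * Real.exp (-u) ≤ Real.exp (-1) := by
    have h1 : u ≤ Real.exp (u - 1) := by linarith [Real.add_one_le_exp (u - 1)]
    calc u * Real.exp (-u) ≤ Real.exp (u - 1) * Real.exp (-u) := by gcongr
      _ = Real.exp (-1) := by
        rw [← Real.exp_add]
        congr 1
        ring
  have hθ : h * (β / 2) * Real.exp (2 * (β / 2)) ≤ d * Real.exp (-1) := by
    calc h * (β / 2) * Real.exp (2 * (β / 2))
        ≤ Real.exp (-(3 * β / (2 * d))) * (β / 2) * Real.exp (2 * (β / 2)) := by gcongr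
      _ = d * u * Real.exp (-(3 * u) + β) := by
          rw [Real.exp_add, show 2 * (β / 2) = β by ring, show 3 * β / (2 * d) = 3 * u by
            rw [hu]; ring, show β / 2 = d * u by rw [hβu]; ring]
          ring
      _ ≤ d * u * Real.exp (-u) := by
          gcongr
          rw [hβu]
          nlinarith
      _ ≤ d * Real.exp (-1) := by
          rw [mul_assoc]
          gcongr
  have h2 := pow_le_pow_left₀ (by positivity) hθ 2
  have he : 0 < Real.exp 1 := Real.exp_pos 1
  have he2 := Real.exp_one_gt_d9
  rw [Real.exp_neg] at h2
  calc (1 + Real.exp 1) * (h * (β / 2) * Real.exp (2 * (β / 2))) ^ 2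
      ≤ (2 * Real.exp 1) * (d * (Real.exp 1)⁻¹) ^ 2 := by
        gcongr
        linarith
    _ = d * (d * (2 / Real.exp 1)) := by
        field_simp
    _ ≤ d * (1 * (3 / 4)) := by
        have h3 : 2 / Real.exp 1 ≤ 3 / 4 := by
          rw [div_le_iff₀ he]
          linarith
        exact mul_le_mul_of_nonneg_left (mul_le_mul hd1 h3 (by positivity) zero_le_one) hd.le
    _ = 3 / 4 * d := by ring

theorem ceil_le_mixingTime {ε b : ℝ} (hε : ε ≤ 1 / 2) {T : SuperOp n}
    (h : ∀ t : ℕ, (∀ ρ σ : Op n, IsState ρ → IsState σ →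
      traceNorm ((T ^ t) (ρ - σ)) ≤ 1 / 2 * traceNorm (ρ - σ)) → b ≤ t) :
    ENNReal.ofReal b ≤ ((mixingTime ε T : ℕ∞) : ℝ≥0∞) := by
  have h1 : ((⌈b⌉₊ : ℕ) : ℕ∞) ≤ mixingTime ε T := by
    refine le_iInf₂ fun t ht => ?_
    exact_mod_cast Nat.ceil_le.2 (h t fun ρ σ hρ hσ =>
      (ht ρ σ hρ hσ).trans (mul_le_mul_of_nonneg_right hε (traceNorm_nonneg _)))
  calc ENNReal.ofReal b ≤ ((⌈b⌉₊ : ℕ) : ℝ≥0∞) := by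
        rw [← ENNReal.ofReal_natCast]
        exact ENNReal.ofReal_le_ofReal (Nat.le_ceil b)
    _ = (((⌈b⌉₊ : ℕ) : ℕ∞) : ℝ≥0∞) := by simp
    _ ≤ _ := by exact_mod_cast h1

theorem exp_half_le_of_half_le {a d w : ℝ} (ha : 0 < a) (hw : 0 < w) {t : ℕ}
    (hnd : 28 / d ≤ n) (hd : 0 < d) (hna : 36 / (a * w) ≤ n)
    (ht : 1 / 2 ≤ 2 * Real.exp (-(d * n / 4))
      + (2 * t + 1) * (Real.exp (-(5 / 6 * a * n)) / w)) :
    Real.exp (a / 2 * n) ≤ t := by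
  have hδ : Real.exp (-(d * n / 4)) ≤ 1 / 8 := by
    rw [div_le_iff₀ hd] at hnd
    rw [Real.exp_neg, inv_le_comm₀ (Real.exp_pos _) (by norm_num)]
    linarith [Real.add_one_le_exp (d * n / 4)]
  have h1 : 1 / 4 ≤ (2 * t + 1) * (Real.exp (-(5 / 6 * a * n)) / w) := by linarith
  rw [Real.exp_neg, inv_eq_one_div, div_div, mul_one_div, le_div_iff₀ (by positivity)] at h1
  have h2 : Real.exp (5 / 6 * a * n) = Real.exp (a / 3 * n) * Real.exp (a / 2 * n) := by
    rw [← Real.exp_add]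
    congr 1
    ring
  have h3 : 12 ≤ Real.exp (a / 3 * n) * w := by
    rw [div_le_iff₀ (by positivity)] at hna
    have := mul_le_mul_of_nonneg_right (Real.add_one_le_exp (a / 3 * n)) hw.le
    nlinarith
  have h4 : 1 ≤ Real.exp (a / 2 * n) := Real.one_le_exp (by positivity)
  rw [h2] at h1
  nlinarith

end Constants

end GibbsMixing

theorem mainTheorem6 (β a d w ε : ℝ) (hβ : 0 < β) (ha : 0 < a) (hd : 0 < d) (hw : 0 < w)
    (hε : ε ≤ 1 / 2) :
    ∃ κ : ℝ, 0 < κ ∧ ∃ N : ℕ, ∀ n : ℕ, N ≤ n →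
      ∀ h : ℝ, 0 ≤ h →
        h < min (min (1 / 2) (1 / β))
          (min (Real.exp (-(3 * β / (2 * d))))
            (Real.sqrt a / (Real.sqrt 3 * β) * Real.exp (-β))) →
      ∀ (ι : Type) [Fintype ι] (term : ι → List (Fin n)) (c : ι → ℝ),
        (∀ j, (GibbsMixing.degree term c : ℝ) * |c j| ≤ 1) →
      ∀ PA PC : GibbsMixing.Op n,
        GibbsMixing.IsDiagProj PA → GibbsMixing.IsDiagProj PC → PA * PC = 0 →
        GibbsMixing.HammingSeparated (d * n) PA PC →
        w ≤ (PA * GibbsMixing.gibbs β (GibbsMixing.classicalHam term c)).trace.re →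
        w ≤ (PC * GibbsMixing.gibbs β (GibbsMixing.classicalHam term c)).trace.re →
        ((1 - PA - PC) * GibbsMixing.gibbs β (GibbsMixing.classicalHam term c)).trace.re
          ≤ Real.exp (-(a * n)) →
      ∀ l : ℕ, (l : ℝ) < d * n →
      ∀ T : GibbsMixing.SuperOp n,
        GibbsMixing.IsLocalGibbsSampler l
          (GibbsMixing.gibbs β
            (GibbsMixing.transverseHam (GibbsMixing.classicalHam term c) h)) T →
        ENNReal.ofReal (Real.exp (κ * n)) ≤ ((GibbsMixing.mixingTime ε T : ℕ∞) : ℝ≥0∞) := by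
  refine ⟨a / 2, by positivity, ⌈28 / d⌉₊ + ⌈36 / (a * w)⌉₊, ?_⟩
  intro n hn h hh hlt ι _ term c hc PA PC hPA hPC _ hsep hA hC hB l hl T hT
  have hnR : ((⌈28 / d⌉₊ : ℕ) : ℝ) + (⌈36 / (a * w)⌉₊ : ℕ) ≤ n := by exact_mod_cast hn
  have hnd : 28 / d ≤ n := by
    have := Nat.cast_nonneg (α := ℝ) ⌈36 / (a * w)⌉₊
    linarith [Nat.le_ceil (28 / d)]
  have hna : 36 / (a * w) ≤ n := by
    have := Nat.cast_nonneg (α := ℝ) ⌈28 / d⌉₊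
    linarith [Nat.le_ceil (36 / (a * w))]
  have hn0 : (0 : ℝ) < n := (by positivity : 0 < 28 / d).trans_le hnd
  obtain ⟨-, hlt⟩ := lt_min_iff.1 hlt
  obtain ⟨hhd, hha⟩ := lt_min_iff.1 hlt
  obtain ⟨A, rfl, hA'⟩ := hPA.exists_eq_regionProj
  obtain ⟨C, rfl, hC'⟩ := hPC.exists_eq_regionProj
  have hsep' : ∀ x ∈ A, ∀ y ∈ C, d * n < (hammingDist x y : ℝ) := fun x hx y hy =>
    hsep x y (hA' x hx) (hC' y hy)
  have hdisj : Disjoint A C := by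
    refine Finset.disjoint_left.2 fun x hxA hxC => ?_
    have := hsep' x hxA x hxC
    rw [hammingDist_self, Nat.cast_zero] at this
    exact absurd this (not_lt.2 (by positivity))
  rw [GibbsMixing.re_trace_regionProj_mul] at hA hC
  rw [GibbsMixing.one_sub_regionProj_sub_regionProj hdisj,
    GibbsMixing.re_trace_regionProj_mul] at hB
  -- Nonempty regions at Hamming distance more than `d n` force `d < 1`.
  have hd1 : d ≤ 1 := by
    have hne : ∀ D : Finset (GibbsMixing.Bits n),
        w ≤ GibbsMixing.mass D (GibbsMixing.gibbs β (GibbsMixing.classicalHam term c)) →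
        D.Nonempty := by
      intro D hD
      rw [Finset.nonempty_iff_ne_empty]
      rintro rfl
      exact absurd (hw.trans_le hD) (by simp [GibbsMixing.mass])
    obtain ⟨x, hx⟩ := hne A hA
    obtain ⟨y, hy⟩ := hne C hC
    have h1 := hsep' x hx y hy
    have h2 : (hammingDist x y : ℝ) ≤ n := by
      have := hammingDist_le_card_fintype (x := x) (y := y)
      rw [Fintype.card_fin] at this
      exact_mod_cast this
    by_contra hcon
    nlinarith
  refine GibbsMixing.ceil_le_mixingTime hε fun t ht => ?_
  exact GibbsMixing.exp_half_le_of_half_le ha hw hnd hd hna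
    (GibbsMixing.half_le_of_gibbs_contraction hc hβ hw hh rfl
      (GibbsMixing.two_mul_flip_rate_sq_le hβ ha hh hha)
      (GibbsMixing.one_add_exp_mul_flip_rate_sq_le hβ hd hd1 hh hhd)
      hsep' hdisj hA hC hB hl hT ht)
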